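/- Let $n\ge 1$, let $p_0,\dots,p_{n-1}>0$ and $p>0$ be real numbers, and consider the Jacobi coefficients $\beta_k=0$ $(k\ge 0)$, $\gamma_k=p_k$ for $0\le k<n$ and $\gamma_k=p$ for $k\ge n$. A measure $\mu$ on $\mathbb{R}$ with finite moments of all orders is said to have these Jacobi coefficients if the monic polynomials defined by $P_0=1$, $P_1(x)=x$, $P_{k+2}(x)=xP_{k+1}(x)-\gamma_kP_k(x)$ are orthogonal with respect to $\mu$. There is a probability measure $\mu$ on $\mathbb{R}$ with these Jacobi coefficients, and for every such $\mu$ its Stieltjes transform $$G^{(n)}(z)=\int_{\mathbb{R}}\frac{d\mu(x)}{z-x},\qquad z\in\mathbb{C}\setminus\operatorname{supp}\mu,$$ is given by $$G^{(n)}(z)=\frac{\Pi_{n-2}(z)}{\Pi_{n-1}(z)},\qquad \Pi_{n-1}(z)\neq 0,$$ where $\Pi_{-1}(z)=1$, $\Pi_0(z)=z-p_{n-1}A(z)$, $$\Pi_k(z)=z\,\Pi_{k-1}(z)-p_{n-(k+1)}\,\Pi_{k-2}(z)\quad(1\le k\le n-1),\qquad A(z)=\frac{z-\sqrt{z^2-4p}}{2p},$$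 and $\sqrt{z^2-4p}$ denotes the product $\sqrt{z-2\sqrt p}\,\sqrt{z+2\sqrt p}$ of principal square roots, i.e. the branch that is holomorphic on $\mathbb{C}\setminus[-2\sqrt p,2\sqrt p]$ and asymptotic to $z$ at infinity. In particular, for $z\in\mathbb{C}\setminus\operatorname{supp}\mu$, $$G^{(1)}(z)=\frac12\cdot\frac{(2p-p_0)z-p_0\sqrt{z^2-4p}}{(p-p_0)z^2+p_0^2}\qquad\text{whenever }(p-p_0)z^2+p_0^2\neq 0,$$ $$G^{(2)}(z)=\frac{(2p-p_1)z+p_1\sqrt{z^2-4p}}{(2p-p_1)z^2-2p_0p+p_1z\sqrt{z^2-4p}},$$ $$G^{(3)}(z)=\frac{(2p-p_2)z^2-2p_1p+p_2z\sqrt{z^2-4p}}{(2p-p_2)z^3+(p_0p_2-2p_0p-2p_1p)z+p_2(z^2-p_0)\sqrt{z^2-4p}},$$ where the denominators of the last two formulas do not vanish. -/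

import Mathlib

open MeasureTheory

noncomputable section

/-- The monic polynomials given by the three-term recurrence with coefficients `β`, `γ`:
`P₀ = 1`, `P₁ = X - β₀`, `X Pₖ = Pₖ₊₁ + βₖ Pₖ + γₖ₋₁ Pₖ₋₁`. -/
def jacobiPoly (β γ : ℕ → ℝ) : ℕ → Polynomial ℝ
  | 0 => 1
  | 1 => Polynomial.X - Polynomial.C (β 0)
  | k + 2 => (Polynomial.X - Polynomial.C (β (k + 1))) * jacobiPoly β γ (k + 1)
      - Polynomial.C (γ k) * jacobiPoly β γ k

/-- `β`, `γ` are the Jacobi coefficients of the measure `μ` on the line: `μ` has finite moments of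
all orders, every `γₖ` is positive, and the monic polynomials generated by `β`, `γ` are
orthogonal with respect to `μ`. -/
structure HasJacobiCoefficients (μ : Measure ℝ) (β γ : ℕ → ℝ) : Prop where
  integrable_pow : ∀ m : ℕ, Integrable (fun x : ℝ => x ^ m) μ
  gamma_pos : ∀ k : ℕ, 0 < γ k
  orthogonal : ∀ i j : ℕ, i ≠ j →
    ∫ x, (jacobiPoly β γ i).eval x * (jacobiPoly β γ j).eval x ∂μ = 0

/-- The Stieltjes transform `G_μ(z) = ∫ dμ(x) / (z - x)`. -/
def stieltjesTransform (μ : Measure ℝ) (z : ℂ) : ℂ :=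
  ∫ x, 1 / (z - (x : ℂ)) ∂μ

/-- The coefficients `γ` of the `(p₀, …, pₙ₋₁, p)`-case: `γₖ = pₖ` for `k < n` and `γₖ = p` for
`k ≥ n`. Only the values `ps k` with `k < n` matter. -/
def gammaSeq (n : ℕ) (ps : ℕ → ℝ) (p : ℝ) (k : ℕ) : ℝ :=
  if k < n then ps k else p

/-- The branch of `√(z² - 4p)` (for `p > 0`) that is holomorphic off `[-2√p, 2√p]` and is
asymptotic to `z` at infinity, as a product of two principal square roots. -/
def sqrtBranch (p : ℝ) (z : ℂ) : ℂ :=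
  (z - 2 * (Real.sqrt p : ℂ)) ^ ((2 : ℂ)⁻¹) * (z + 2 * (Real.sqrt p : ℂ)) ^ ((2 : ℂ)⁻¹)

theorem sqrtBranch_sq {p : ℝ} (hp : 0 ≤ p) (z : ℂ) : sqrtBranch p z ^ 2 = z ^ 2 - 4 * (p : ℂ) := by
  have h : (Real.sqrt p : ℂ) ^ 2 = (p : ℂ) := by
    rw [← Complex.ofReal_pow, Real.sq_sqrt hp]
  have e (w : ℂ) : (w ^ ((2 : ℂ)⁻¹)) ^ 2 = w := by
    exact Complex.cpow_nat_inv_pow w (n := 2) two_ne_zero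
  rw [sqrtBranch, mul_pow, e, e, ← h]
  ring

/-- `A(z) = (z - √(z² - 4p)) / (2p)`. -/
def tailA (p : ℝ) (z : ℂ) : ℂ :=
  (z - sqrtBranch p z) / (2 * (p : ℂ))

/-- The functions `Πₖ`, with the index shifted by one: `shiftedPi n ps p z j` is `Π_{j-1}(z)`.
So `Π₋₁ = 1`, `Π₀ = z - pₙ₋₁ A(z)` and `Πₖ = z Πₖ₋₁ - pₙ₋₍ₖ₊₁₎ Πₖ₋₂`, for `1 ≤ k ≤ n - 1`.
(The natural-number subtraction truncates only for values of the index above `n`.) -/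
def shiftedPi (n : ℕ) (ps : ℕ → ℝ) (p : ℝ) (z : ℂ) : ℕ → ℂ
  | 0 => 1
  | 1 => z - (ps (n - 1) : ℂ) * tailA p z
  | j + 2 => z * shiftedPi n ps p z (j + 1) - (ps (n - (j + 2)) : ℂ) * shiftedPi n ps p z j

end

open Filter Topology ComplexConjugate InnerProductSpace

/-! The functions of the second kind `q k` = ∫ Pₖ(x)/(z - x) dμ obey the recurrence of the Pₖ, with
`q 0` = G(z) and `q 1` = zG(z) - 1. Up to the factor ‖Pₖ‖ they are the coefficients of 1/(z - x)
along an orthonormal family in L²(μ), so Bessel's inequality gives |`q k`|²/‖Pₖ‖² → 0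
(`tendsto_secondKind`). From index n on the coefficients are constant, with characteristic roots (z
± s)/2, s = √(z² - 4p). Decay excludes the root of larger modulus, so `q (n+1)` = (z - s)/2 · `q n`
(`eq_mul_of_recurrence_of_tendsto`). Eliminating backwards from this tail condition to `q 0`
produces the Πₖ (`shiftedPi_ne_zero_and_div`).

For existence, bounded γ define a bounded self-adjoint Jacobi operator on ℓ²; its spectral measure
at the first unit vector has the required coefficients. -/

/-! ### The branch of the square root -/

theorem re_mul_conj_sqrtBranch_nonneg (p : ℝ) (z : ℂ) : 0 ≤ (z * conj (sqrtBranch p z)).re := by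
  set a := z - 2 * (Real.sqrt p : ℂ) with ha
  set b := z + 2 * (Real.sqrt p : ℂ) with hb
  set u := a ^ ((2 : ℂ)⁻¹) with hu
  set v := b ^ ((2 : ℂ)⁻¹) with hv
  have hu2 : u ^ 2 = a := Complex.cpow_nat_inv_pow a (n := 2) two_ne_zero
  have hv2 : v ^ 2 = b := Complex.cpow_nat_inv_pow b (n := 2) two_ne_zero
  have hz : z = (u ^ 2 + v ^ 2) / 2 := by rw [hu2, hv2, ha, hb]; ring
  have hs : sqrtBranch p z = u * v := rfl
  have hre : 0 ≤ u.re * v.re := by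
    rw [hu, hv, Complex.cpow_inv_two_re, Complex.cpow_inv_two_re]; positivity
  -- The radicands differ by a real number, so their principal roots have imaginary parts of the
  -- same sign.
  have him : 0 ≤ u.im * v.im := by
    have ha_im : a.im = z.im := by simp [ha]
    have hb_im : b.im = z.im := by simp [hb]
    rcases le_or_gt 0 z.im with h | h
    · rw [hu, hv, Complex.cpow_inv_two_im_eq_sqrt (ha_im ▸ h),
        Complex.cpow_inv_two_im_eq_sqrt (hb_im ▸ h)]
      positivity
    · rw [hu, hv, Complex.cpow_inv_two_im_eq_neg_sqrt (ha_im ▸ h),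
        Complex.cpow_inv_two_im_eq_neg_sqrt (hb_im ▸ h), neg_mul_neg]
      positivity
  have key : (z * conj (sqrtBranch p z)).re
      = (u.re ^ 2 + u.im ^ 2 + v.re ^ 2 + v.im ^ 2) * (u.re * v.re + u.im * v.im) / 2 := by
    have hz2 : (z * conj (sqrtBranch p z)) = (1 / 2 : ℝ) * ((u ^ 2 + v ^ 2) * conj (u * v)) := by
      rw [hs]; nth_rewrite 1 [hz]; push_cast; ring
    rw [hz2, Complex.re_ofReal_mul]
    simp only [pow_two, Complex.mul_re, Complex.add_re, Complex.add_im, Complex.mul_im,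
      Complex.conj_re, Complex.conj_im]
    ring
  rw [key]
  positivity

/-- The numbers (z ± s)/2 have product p, and Re(z s̄) ≥ 0 makes the one with the plus sign the
larger in modulus. -/
theorem le_norm_sq_half_add_sqrtBranch {p : ℝ} (hp : 0 < p) (z : ℂ) :
    p ≤ ‖(z + sqrtBranch p z) / 2‖ ^ 2 := by
  set s := sqrtBranch p z with hs
  have h1 : ((z + s) / 2) * ((z - s) / 2) = p := by
    have := sqrtBranch_sq hp.le z
    rw [← hs] at this
    linear_combination (-1 / 4 : ℂ) * this
  have h2 : ‖(z - s) / 2‖ ≤ ‖(z + s) / 2‖ := by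
    rw [norm_div, norm_div]
    gcongr
    rw [← sq_le_sq₀ (norm_nonneg _) (norm_nonneg _), ← Complex.normSq_eq_norm_sq,
      ← Complex.normSq_eq_norm_sq, Complex.normSq_sub, Complex.normSq_add]
    linarith [re_mul_conj_sqrtBranch_nonneg p z]
  have h3 : ‖(z + s) / 2‖ * ‖(z - s) / 2‖ = p := by
    rw [← norm_mul, h1, Complex.norm_real, Real.norm_of_nonneg hp.le]
  nlinarith [norm_nonneg ((z + s) / 2)]

/-! ### Decaying solutions and backward elimination -/

/-- The defect `r k` = `q (k+1)` - a `q k` is multiplied by b at each step. As ‖b‖² ≥ p, the ratio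
‖`r k`‖²/`h k` cannot decrease from n on; it also tends to 0, so it vanishes. No strict inequality
‖a‖ < ‖b‖ is needed, so points of the cut off the support are covered. -/
theorem eq_mul_of_recurrence_of_tendsto {h : ℕ → ℝ} (hpos : ∀ k, 0 < h k) {q : ℕ → ℂ} {p : ℝ} {a b : ℂ}
    (hab : a * b = p) (hb : p ≤ ‖b‖ ^ 2) {n : ℕ}
    (hh : ∀ k, n ≤ k → h (k + 1) = p * h k)
    (hq : ∀ k, n ≤ k → q (k + 2) = (a + b) * q (k + 1) - p * q k)
    (hlim : Tendsto (fun k => ‖q k‖ ^ 2 / h k) atTop (𝓝 0)) : q (n + 1) = a * q n := by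
  have hp : 0 < p := by
    have := hh n le_rfl
    have h1 := hpos (n + 1)
    rw [this] at h1
    exact pos_of_mul_pos_left h1 (hpos n).le
  set r : ℕ → ℂ := fun k => q (k + 1) - a * q k with hr
  have hrec : ∀ k, n ≤ k → r (k + 1) = b * r k := fun k hk => by
    simp only [hr]; rw [hq k hk, ← hab]; ring
  have hmono : ∀ k, n ≤ k → ‖r n‖ ^ 2 / h n ≤ ‖r k‖ ^ 2 / h k := by
    intro k hk
    induction k, hk using Nat.le_induction with
    | base => exact le_rfl
    | succ k hk ih =>
      refine ih.trans ?_
      rw [hrec k hk, hh k hk, norm_mul, mul_pow, mul_div_mul_comm]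
      exact le_mul_of_one_le_left (div_nonneg (sq_nonneg _) (hpos k).le) ((one_le_div hp).2 hb)
  have hupper : ∀ k, n ≤ k →
      ‖r k‖ ^ 2 / h k ≤ 2 * p * (‖q (k + 1)‖ ^ 2 / h (k + 1)) + 2 * ‖a‖ ^ 2 * (‖q k‖ ^ 2 / h k) := by
    intro k hk
    have h1 : ‖r k‖ ^ 2 ≤ 2 * ‖q (k + 1)‖ ^ 2 + 2 * ‖a‖ ^ 2 * ‖q k‖ ^ 2 := by
      have : ‖r k‖ ≤ ‖q (k + 1)‖ + ‖a‖ * ‖q k‖ := by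
        rw [← norm_mul]; exact norm_sub_le _ _
      nlinarith [sq_nonneg (‖q (k + 1)‖ - ‖a‖ * ‖q k‖), norm_nonneg (r k)]
    rw [hh k hk]
    have := hpos k
    rw [div_le_iff₀ this]
    refine h1.trans_eq ?_
    field_simp
  have hlim' : Tendsto (fun k => 2 * p * (‖q (k + 1)‖ ^ 2 / h (k + 1))
      + 2 * ‖a‖ ^ 2 * (‖q k‖ ^ 2 / h k)) atTop (𝓝 0) := by
    simpa using ((hlim.comp (tendsto_add_atTop_nat 1)).const_mul (2 * p)).add
      (hlim.const_mul (2 * ‖a‖ ^ 2))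
  have h0 : ‖r n‖ ^ 2 / h n ≤ 0 := ge_of_tendsto hlim' <|
    (eventually_ge_atTop n).mono fun k hk => (hmono k hk).trans (hupper k hk)
  have h1 : ‖r n‖ ^ 2 ≤ 0 := by
    have := (div_le_iff₀ (hpos n)).1 h0
    simpa using this
  have h2 : r n = 0 := by
    have : ‖r n‖ = 0 := by nlinarith [norm_nonneg (r n)]
    simpa using this
  exact sub_eq_zero.1 h2

theorem shiftedPi_ne_zero_and_div {n : ℕ} {ps : ℕ → ℝ} {p : ℝ} {z : ℂ} (hn : 1 ≤ n)
    (hps : ∀ k, k < n → ps k ≠ 0) {q : ℕ → ℂ} (h0 : q 1 = z * q 0 - 1)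
    (hq : ∀ k, k + 1 < n → q (k + 2) = z * q (k + 1) - ps k * q k)
    (htail : q n = ps (n - 1) * tailA p z * q (n - 1)) :
    shiftedPi n ps p z n ≠ 0 ∧ q 0 = shiftedPi n ps p z (n - 1) / shiftedPi n ps p z n := by
  obtain ⟨m, rfl⟩ : ∃ m, n = m + 1 := ⟨n - 1, by omega⟩
  -- `R` prepends the value `1` to `q`, so that all steps have the same shape
  let R : ℕ → ℂ := fun k => Nat.casesOn k 1 q
  let g : ℕ → ℂ := fun k => Nat.casesOn k 1 fun i => (ps i : ℂ)
  have hR : ∀ k, k < m + 1 → R (k + 2) = z * R (k + 1) - g k * R k := by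
    rintro (_ | k) hk
    · change q 1 = z * q 0 - 1 * 1
      rw [h0, one_mul]
    · exact hq k hk
  -- This is the continued fraction for `R (k+1) / R k`, cleared of denominators because nothing is
  -- yet known to be nonzero.
  have hstep : ∀ j k, j + k = m →
      shiftedPi (m + 1) ps p z (j + 1) * R (k + 1) = g k * shiftedPi (m + 1) ps p z j * R k := by
    intro j
    induction j with
    | zero =>
      intro k hk
      obtain rfl : k = m := by omega
      have ht : R (k + 2) = ps k * tailA p z * R (k + 1) := htail
      have := hR k (by omega)
      simp only [shiftedPi, Nat.add_sub_cancel]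
      linear_combination ht - this
    | succ j ih =>
      intro k hk
      have h3 := ih (k + 1) (by omega)
      have hg : g (k + 1) = ps k := rfl
      have e : m + 1 - (j + 2) = k := by omega
      simp only [shiftedPi, e]
      rw [hR k (by omega), hg] at h3
      linear_combination h3
  -- Two consecutive zeros would propagate down to Π₋₁ = 1, as all `ps k` are nonzero. By `hstep`, a
  -- zero of the last Π forces one of its predecessor.
  have hne : ∀ j, j ≤ m → shiftedPi (m + 1) ps p z j ≠ 0 ∨ shiftedPi (m + 1) ps p z (j + 1) ≠ 0 := by
    intro j
    induction j with
    | zero => intro _; left; simp [shiftedPi]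
    | succ j ih =>
      intro hj
      by_contra! hcon
      have h2 := hcon.2
      simp only [shiftedPi, hcon.1, mul_zero, zero_sub, neg_eq_zero, mul_eq_zero] at h2
      rcases ih (by omega) with h | h
      · exact h2.elim (fun h' => hps (m + 1 - (j + 2)) (by omega) (by exact_mod_cast h')) h
      · exact h hcon.1
  have h3' : shiftedPi (m + 1) ps p z (m + 1) * q 0 = shiftedPi (m + 1) ps p z m := by
    simpa [R, g] using hstep m 0 rfl
  have hnz : shiftedPi (m + 1) ps p z (m + 1) ≠ 0 := by
    intro h
    rw [h, zero_mul] at h3'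
    exact (hne m le_rfl).elim (fun h' => h' h3'.symm) (fun h' => h' h)
  exact ⟨hnz, by rw [Nat.add_sub_cancel, ← h3', mul_div_cancel_left₀ _ hnz]⟩

/-! ### Integrability and squared norms of the polynomials -/

theorem integrable_eval_of_integrable_pow {μ : Measure ℝ}
    (h : ∀ m : ℕ, Integrable (fun x : ℝ => x ^ m) μ) (q : Polynomial ℝ) :
    Integrable (fun x => q.eval x) μ := by
  simp only [Polynomial.eval_eq_sum_range]
  exact integrable_finsetSum _ fun i _ => (h i).const_mul _

theorem jacobiPoly_zero_mul_X (γ : ℕ → ℝ) (k : ℕ) :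
    Polynomial.X * jacobiPoly (fun _ => 0) γ (k + 1)
      = jacobiPoly (fun _ => 0) γ (k + 2) + Polynomial.C (γ k) * jacobiPoly (fun _ => 0) γ k := by
  simp [jacobiPoly]

namespace HasJacobiCoefficients

variable {μ : Measure ℝ} {γ : ℕ → ℝ}

/-- Both sides equal ∫ x Pₖ₊₁ Pₖ dμ: apply the recurrence to x Pₖ or to x Pₖ₊₁. -/
theorem integral_sq_succ (h : HasJacobiCoefficients μ (fun _ => 0) γ) (k : ℕ) :
    ∫ x, (jacobiPoly (fun _ => 0) γ (k + 1)).eval x * (jacobiPoly (fun _ => 0) γ (k + 1)).eval x ∂μ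
      = γ k *
        ∫ x, (jacobiPoly (fun _ => 0) γ k).eval x * (jacobiPoly (fun _ => 0) γ k).eval x ∂μ := by
  set P := jacobiPoly (fun _ => 0) γ with hP
  have hint (a b : ℕ) : Integrable (fun x => (P a).eval x * (P b).eval x) μ := by
    simpa using integrable_eval_of_integrable_pow h.integrable_pow (P a * P b)
  have h1 : ∫ x, (P (k + 1)).eval x * (P (k + 1)).eval x ∂μ
      = ∫ x, x * (P (k + 1)).eval x * (P k).eval x ∂μ := by
    rcases k with _ | k
    · have e0 : ∀ x, (P 0).eval x = 1 := by simp [hP, jacobiPoly]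
      have e1 : ∀ x, (P (0 + 1)).eval x = x := by simp [hP, jacobiPoly]
      simp [e0, e1]
    · have e : ∀ x, x * (P (k + 2)).eval x * (P (k + 1)).eval x
          = (P (k + 2)).eval x * (P (k + 2)).eval x
            + γ k * ((P (k + 2)).eval x * (P k).eval x) := by
        intro x
        have := congrArg (Polynomial.eval x) (jacobiPoly_zero_mul_X γ k)
        simp only [Polynomial.eval_mul, Polynomial.eval_X, Polynomial.eval_add,
          Polynomial.eval_C, ← hP] at this
        linear_combination (P (k + 2)).eval x * this
      simp only [e]
      rw [integral_add (hint _ _) ((hint _ _).const_mul _), integral_const_mul,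
        h.orthogonal (k + 2) k (by omega), mul_zero, add_zero]
  have e : ∀ x, x * (P (k + 1)).eval x * (P k).eval x
      = (P (k + 2)).eval x * (P k).eval x + γ k * ((P k).eval x * (P k).eval x) := by
    intro x
    have := congrArg (Polynomial.eval x) (jacobiPoly_zero_mul_X γ k)
    simp only [Polynomial.eval_mul, Polynomial.eval_X, Polynomial.eval_add,
      Polynomial.eval_C, ← hP] at this
    linear_combination (P k).eval x * this
  rw [h1]
  simp only [e]
  rw [integral_add (hint _ _) ((hint _ _).const_mul _), integral_const_mul,
    h.orthogonal (k + 2) k (by omega), zero_add]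

theorem integral_sq_pos [IsProbabilityMeasure μ] (h : HasJacobiCoefficients μ (fun _ => 0) γ)
    (k : ℕ) :
    0 < ∫ x, (jacobiPoly (fun _ => 0) γ k).eval x * (jacobiPoly (fun _ => 0) γ k).eval x ∂μ := by
  induction k with
  | zero => simp [jacobiPoly]
  | succ k ih => rw [h.integral_sq_succ]; exact mul_pos (h.gamma_pos k) ih

end HasJacobiCoefficients

/-! ### Functions of the second kind -/

/-- A point off the support has positive distance from it. -/
theorem exists_pos_ae_le_norm_sub {μ : Measure ℝ} {z : ℂ} (hz : ∀ x ∈ μ.support, (x : ℂ) ≠ z) :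
    ∃ ε > 0, ∀ᵐ x : ℝ ∂μ, ε ≤ ‖z - (x : ℂ)‖ := by
  have hcl : IsClosed ((fun x : ℝ => (x : ℂ)) '' μ.support) :=
    Complex.isometry_ofReal.isClosedEmbedding.isClosedMap _ Measure.isClosed_support
  have hmem : ((fun x : ℝ => (x : ℂ)) '' μ.support)ᶜ ∈ 𝓝 z :=
    hcl.isOpen_compl.mem_nhds (by rintro ⟨x, hx, rfl⟩; exact hz x hx rfl)
  obtain ⟨ε, hε, hball⟩ := Metric.mem_nhds_iff.1 hmem
  refine ⟨ε, hε, ?_⟩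
  filter_upwards [Measure.support_mem_ae (μ := μ)] with x hx
  by_contra! hlt
  exact hball (show (x : ℂ) ∈ Metric.ball z ε by rwa [Metric.mem_ball, dist_comm, dist_eq_norm])
    ⟨x, hx, rfl⟩

theorem memLp_one_div_sub {μ : Measure ℝ} [IsFiniteMeasure μ] {z : ℂ}
    (hz : ∀ x ∈ μ.support, (x : ℂ) ≠ z) (p : ENNReal) :
    MemLp (fun x : ℝ => 1 / (z - (x : ℂ))) p μ := by
  obtain ⟨ε, hε, hae⟩ := exists_pos_ae_le_norm_sub hz
  have hm : Measurable fun x : ℝ => 1 / (z - (x : ℂ)) := by fun_prop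
  refine MemLp.of_bound hm.aestronglyMeasurable (1 / ε) ?_
  filter_upwards [hae] with x hx
  rw [norm_div, norm_one]
  gcongr

/-- The functions of the second kind `∫ Pₖ(x) / (z - x) dμ(x)`. -/
noncomputable def secondKind (μ : Measure ℝ) (γ : ℕ → ℝ) (z : ℂ) (k : ℕ) : ℂ :=
  ∫ x, (((jacobiPoly (fun _ => 0) γ k).eval x : ℝ) : ℂ) * (1 / (z - (x : ℂ))) ∂μ

theorem secondKind_zero (μ : Measure ℝ) (γ : ℕ → ℝ) (z : ℂ) :
    secondKind μ γ z 0 = stieltjesTransform μ z := by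
  simp [secondKind, stieltjesTransform, jacobiPoly]

namespace HasJacobiCoefficients

variable {μ : Measure ℝ} {γ : ℕ → ℝ} {z : ℂ}

theorem integrable_eval_div [IsFiniteMeasure μ]
    (h : HasJacobiCoefficients μ (fun _ => 0) γ) (hz : ∀ x ∈ μ.support, (x : ℂ) ≠ z)
    (q : Polynomial ℝ) :
    Integrable (fun x => ((q.eval x : ℝ) : ℂ) * (1 / (z - (x : ℂ)))) μ := by
  have h1 : Integrable (fun x => ((q.eval x : ℝ) : ℂ)) μ :=
    (integrable_eval_of_integrable_pow h.integrable_pow q).ofReal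
  have h2 := memLp_one_div_sub hz ⊤
  exact h1.mul_of_top_left h2

/-- Multiplication by `z` under the integral differs from multiplication by `x` by `∫ q dμ`. -/
theorem integral_X_mul_div [IsFiniteMeasure μ]
    (h : HasJacobiCoefficients μ (fun _ => 0) γ) (hz : ∀ x ∈ μ.support, (x : ℂ) ≠ z)
    (q : Polynomial ℝ) :
    ∫ x, (((Polynomial.X * q).eval x : ℝ) : ℂ) * (1 / (z - (x : ℂ))) ∂μ
      = z * ∫ x, ((q.eval x : ℝ) : ℂ) * (1 / (z - (x : ℂ))) ∂μ - ((∫ x, q.eval x ∂μ : ℝ) : ℂ) := by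
  have h1 : Integrable (fun x => ((q.eval x : ℝ) : ℂ)) μ :=
    (integrable_eval_of_integrable_pow h.integrable_pow q).ofReal
  rw [← integral_const_mul, ← integral_complex_ofReal,
    ← integral_sub ((h.integrable_eval_div hz q).const_mul z) h1]
  obtain ⟨ε, hε, hae⟩ := exists_pos_ae_le_norm_sub hz
  -- Pointwise, x/(z - x) = z/(z - x) - 1.
  refine integral_congr_ae ?_
  filter_upwards [hae] with x hx
  have : z - (x : ℂ) ≠ 0 := norm_pos_iff.1 (hε.trans_le hx)
  simp only [Polynomial.eval_mul, Polynomial.eval_X]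
  push_cast
  field_simp
  simp
  ring

theorem secondKind_one [IsProbabilityMeasure μ]
    (h : HasJacobiCoefficients μ (fun _ => 0) γ) (hz : ∀ x ∈ μ.support, (x : ℂ) ≠ z) :
    secondKind μ γ z 1 = z * secondKind μ γ z 0 - 1 := by
  simpa [secondKind, jacobiPoly] using h.integral_X_mul_div hz 1

theorem secondKind_add_two [IsProbabilityMeasure μ]
    (h : HasJacobiCoefficients μ (fun _ => 0) γ) (hz : ∀ x ∈ μ.support, (x : ℂ) ≠ z) (k : ℕ) :
    secondKind μ γ z (k + 2) = z * secondKind μ γ z (k + 1) - γ k * secondKind μ γ z k := by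
  have h1 := h.integral_X_mul_div hz (jacobiPoly (fun _ => 0) γ (k + 1))
  have h0 : ∫ x, (jacobiPoly (fun _ => 0) γ (k + 1)).eval x ∂μ = 0 := by
    simpa [jacobiPoly] using h.orthogonal (k + 1) 0 (by omega)
  have h2 : ∫ x, (((Polynomial.X * jacobiPoly (fun _ => 0) γ (k + 1)).eval x : ℝ) : ℂ)
      * (1 / (z - (x : ℂ))) ∂μ = secondKind μ γ z (k + 2) + γ k * secondKind μ γ z k := by
    rw [secondKind, secondKind, ← integral_const_mul,
      ← integral_add (h.integrable_eval_div hz _) ((h.integrable_eval_div hz _).const_mul _),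
      jacobiPoly_zero_mul_X]
    refine integral_congr_ae (ae_of_all _ fun x => ?_)
    simp only [Polynomial.eval_mul, Polynomial.eval_add, Polynomial.eval_C]
    push_cast
    ring
  rw [h2, h0] at h1
  simp only [secondKind] at h1 ⊢
  push_cast at h1 ⊢
  linear_combination h1

/-- Bessel's inequality for the bounded function 1/(z - x) against the orthonormal family Pₖ/‖Pₖ‖ in
L²(μ): the squared coefficients are summable. -/
theorem tendsto_secondKind [IsProbabilityMeasure μ]
    (h : HasJacobiCoefficients μ (fun _ => 0) γ) (hz : ∀ x ∈ μ.support, (x : ℂ) ≠ z) :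
    Tendsto (fun k => ‖secondKind μ γ z k‖ ^ 2 /
      ∫ x, (jacobiPoly (fun _ => 0) γ k).eval x * (jacobiPoly (fun _ => 0) γ k).eval x ∂μ)
      atTop (𝓝 0) := by
  set P := jacobiPoly (fun _ => 0) γ with hP
  set H : ℕ → ℝ := fun k => ∫ x, (P k).eval x * (P k).eval x ∂μ with hH
  have hHpos : ∀ k, 0 < H k := h.integral_sq_pos
  have hmem (k : ℕ) : MemLp (fun x => (((P k).eval x / √(H k) : ℝ) : ℂ)) 2 μ := by
    suffices hr : MemLp (fun x => (P k).eval x / √(H k)) 2 μ from hr.ofReal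
    rw [memLp_two_iff_integrable_sq
      ((P k).continuous.div_const _).measurable.aestronglyMeasurable]
    have := (integrable_eval_of_integrable_pow h.integrable_pow (P k * P k)).div_const (H k)
    refine this.congr (ae_of_all _ fun x => ?_)
    beta_reduce
    rw [Polynomial.eval_mul, div_pow, Real.sq_sqrt (hHpos k).le, pow_two]
  have hf := memLp_one_div_sub hz 2
  have horth : Orthonormal ℂ (fun k => (hmem k).toLp) := by
    rw [orthonormal_iff_ite]
    intro i j
    rw [L2.inner_def]
    have e : ∫ x, ⟪(hmem i).toLp _ x, (hmem j).toLp _ x⟫_ℂ ∂μ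
        = (((∫ x, (P i).eval x * (P j).eval x ∂μ) / (√(H i) * √(H j)) : ℝ) : ℂ) := by
      rw [← integral_div, ← integral_complex_ofReal]
      refine integral_congr_ae ?_
      filter_upwards [(hmem i).coeFn_toLp, (hmem j).coeFn_toLp] with x hi hj
      rw [hi, hj]
      simp
      ring
    rw [e]
    split_ifs with hij
    · subst hij
      rw [Real.mul_self_sqrt (hHpos i).le, div_self (hHpos i).ne', Complex.ofReal_one]
    · rw [h.orthogonal i j hij]; simp
  have hsum := horth.inner_products_summable hf.toLp
  refine hsum.tendsto_atTop_zero.congr fun k => ?_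
  have e : ⟪(hmem k).toLp, hf.toLp⟫_ℂ = secondKind μ γ z k / (√(H k) : ℂ) := by
    rw [L2.inner_def, secondKind, ← integral_div]
    refine integral_congr_ae ?_
    filter_upwards [(hmem k).coeFn_toLp, hf.coeFn_toLp] with x hi hj
    rw [hi, hj]
    simp [← hP]
    ring
  rw [e, norm_div, div_pow, Complex.norm_real, Real.norm_of_nonneg (Real.sqrt_nonneg _),
    Real.sq_sqrt (hHpos k).le]

end HasJacobiCoefficients

/-! ### The formula for the Stieltjes transform -/

theorem stieltjesTransform_eq_shiftedPi_div {n : ℕ} (hn : 1 ≤ n) {ps : ℕ → ℝ} {p : ℝ}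
    (hps : ∀ k, k < n → 0 < ps k) (hp : 0 < p) {μ : Measure ℝ} [IsProbabilityMeasure μ]
    (h : HasJacobiCoefficients μ (fun _ => 0) (gammaSeq n ps p)) {z : ℂ}
    (hz : ∀ x ∈ μ.support, (x : ℂ) ≠ z) :
    shiftedPi n ps p z n ≠ 0 ∧
      stieltjesTransform μ z = shiftedPi n ps p z (n - 1) / shiftedPi n ps p z n := by
  set q := secondKind μ (gammaSeq n ps p) z with hq
  set s := sqrtBranch p z with hs
  have hpC : (p : ℂ) ≠ 0 := by exact_mod_cast hp.ne'
  have hs2 : s ^ 2 = z ^ 2 - 4 * (p : ℂ) := sqrtBranch_sq hp.le z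
  have hrec : ∀ k, q (k + 2) = z * q (k + 1) - gammaSeq n ps p k * q k :=
    h.secondKind_add_two hz
  have htail : q (n + 1) = (z - s) / 2 * q n := by
    refine eq_mul_of_recurrence_of_tendsto (b := (z + s) / 2) (p := p) h.integral_sq_pos
      (by linear_combination (-1 / 4 : ℂ) * hs2) (le_norm_sq_half_add_sqrtBranch hp z)
      (fun k hk => ?_) (fun k hk => ?_) (h.tendsto_secondKind hz)
    · rw [h.integral_sq_succ, gammaSeq, if_neg (by omega)]
    · rw [hrec k, gammaSeq, if_neg (by omega)]; ring
  rw [← secondKind_zero μ (gammaSeq n ps p) z]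
  refine shiftedPi_ne_zero_and_div hn (fun k hk => (hps k hk).ne') (h.secondKind_one hz)
    (fun k hk => ?_) ?_
  · rw [← hq, hrec k, gammaSeq, if_pos (by omega)]
  -- The decay argument only gives `q (n+1)` in terms of `q n`. One more step of the recurrence,
  -- with coefficient pₙ₋₁, gives the relation of `q n` to `q (n-1)`; multiplying by (z - s)/2 turns
  -- (z + s)/2 into p.
  · obtain ⟨m, rfl⟩ : ∃ m, n = m + 1 := ⟨n - 1, by omega⟩
    have h1 := hrec m
    rw [htail, gammaSeq, if_pos (by omega)] at h1
    have h2 : (z + s) / 2 * q (m + 1) = ps m * q m := by linear_combination -h1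
    have h3 : (p : ℂ) * q (m + 1) = (z - s) / 2 * (ps m * q m) := by
      linear_combination (z - s) / 2 * h2 + (1 / 4 : ℂ) * q (m + 1) * hs2
    rw [← hq, Nat.add_sub_cancel, tailA, ← hs]
    field_simp
    linear_combination 2 * h3

/-! ### Jacobi operators on ℓ² -/

theorem sum_norm_weightedShift_le {a : ℕ → ℝ} {M : ℝ} (ha : ∀ k, |a k| ≤ M)
    (f : lp (fun _ : ℕ => ℂ) 2) (s : Finset ℕ) :
    ∑ k ∈ s, ‖(a k : ℂ) * f (k + 1)‖ ^ (2 : ENNReal).toReal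
      ≤ (M * ‖f‖) ^ (2 : ENNReal).toReal := by
  have hM : 0 ≤ M := (abs_nonneg _).trans (ha 0)
  have h := lp.sum_rpow_le_norm_rpow (p := 2) (by norm_num) f
    (s.map ⟨Nat.succ, Nat.succ_injective⟩)
  simp only [ENNReal.toReal_ofNat, Real.rpow_ofNat, Finset.sum_map, Function.Embedding.coeFn_mk,
    Nat.succ_eq_add_one] at h ⊢
  rw [mul_pow]
  refine le_trans ?_ (mul_le_mul_of_nonneg_left h (sq_nonneg M))
  rw [Finset.mul_sum]
  refine Finset.sum_le_sum fun k _ => ?_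
  rw [norm_mul, mul_pow, Complex.norm_real, Real.norm_eq_abs]
  gcongr
  exact ha k

/-- The weighted backward shift `(f k) ↦ (aₖ f (k + 1))` on `ℓ²`, for bounded weights. -/
noncomputable def weightedShift (a : ℕ → ℝ) (M : ℝ) (ha : ∀ k, |a k| ≤ M) :
    lp (fun _ : ℕ => ℂ) 2 →L[ℂ] lp (fun _ : ℕ => ℂ) 2 :=
  LinearMap.mkContinuous
    { toFun := fun f => ⟨fun k => (a k : ℂ) * f (k + 1), memℓp_gen' (sum_norm_weightedShift_le ha f)⟩
      map_add' := fun f g => by ext k; exact mul_add _ _ _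
      map_smul' := fun c f => by ext k; simp; ring }
    M fun f => lp.norm_le_of_forall_sum_le (by norm_num)
      (mul_nonneg ((abs_nonneg _).trans (ha 0)) (norm_nonneg _)) (sum_norm_weightedShift_le ha f)

theorem weightedShift_apply (a : ℕ → ℝ) (M : ℝ) (ha : ∀ k, |a k| ≤ M)
    (f : lp (fun _ : ℕ => ℂ) 2) (k : ℕ) : weightedShift a M ha f k = a k * f (k + 1) := rfl

/-- The Jacobi operator with zero diagonal and off-diagonal weights `a`. -/
noncomputable def jacobiOperator (a : ℕ → ℝ) (M : ℝ) (ha : ∀ k, |a k| ≤ M) :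
    lp (fun _ : ℕ => ℂ) 2 →L[ℂ] lp (fun _ : ℕ => ℂ) 2 :=
  weightedShift a M ha + ContinuousLinearMap.adjoint (weightedShift a M ha)

theorem isSelfAdjoint_jacobiOperator (a : ℕ → ℝ) (M : ℝ) (ha : ∀ k, |a k| ≤ M) :
    IsSelfAdjoint (jacobiOperator a M ha) :=
  IsSelfAdjoint.add_star_self _

/-- The standard unit vectors of `ℓ²`. -/
noncomputable def unitVec (k : ℕ) : lp (fun _ : ℕ => ℂ) 2 := lp.single 2 k 1

theorem inner_unitVec_left (k : ℕ) (f : lp (fun _ : ℕ => ℂ) 2) : ⟪unitVec k, f⟫_ℂ = f k := by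
  simp [unitVec, lp.inner_single_left]

theorem inner_unitVec (i j : ℕ) : ⟪unitVec i, unitVec j⟫_ℂ = if i = j then 1 else 0 := by
  rw [inner_unitVec_left, unitVec, lp.single_apply, Pi.single_apply]

theorem weightedShift_unitVec_zero (a : ℕ → ℝ) (M : ℝ) (ha : ∀ k, |a k| ≤ M) :
    weightedShift a M ha (unitVec 0) = 0 := by
  ext k
  simp [weightedShift_apply, unitVec]

theorem weightedShift_unitVec_succ (a : ℕ → ℝ) (M : ℝ) (ha : ∀ k, |a k| ≤ M) (i : ℕ) :
    weightedShift a M ha (unitVec (i + 1)) = (a i : ℂ) • unitVec i := by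
  ext k
  rw [weightedShift_apply, lp.coeFn_smul, Pi.smul_apply, smul_eq_mul]
  by_cases h : k = i <;> simp [unitVec, h]

theorem adjoint_weightedShift_unitVec (a : ℕ → ℝ) (M : ℝ) (ha : ∀ k, |a k| ≤ M) (i : ℕ) :
    ContinuousLinearMap.adjoint (weightedShift a M ha) (unitVec i)
      = (a i : ℂ) • unitVec (i + 1) := by
  ext k
  rw [← inner_unitVec_left, ContinuousLinearMap.adjoint_inner_right, ← inner_conj_symm,
    inner_unitVec_left, weightedShift_apply, lp.coeFn_smul, Pi.smul_apply, smul_eq_mul]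
  by_cases h : k = i + 1
  · subst h; simp [unitVec]
  · simp [unitVec, h, Ne.symm h]

/-- This turns orthogonality of the polynomials in the spectral measure at `e 0` into orthogonality
of the `e k`. -/
theorem aeval_jacobiPoly_apply {E : Type*} [NormedAddCommGroup E] [InnerProductSpace ℂ E]
    {T : E →L[ℂ] E} {e : ℕ → E} {γ : ℕ → ℝ} (hγ : ∀ k, 0 ≤ γ k)
    (h0 : T (e 0) = (√(γ 0) : ℂ) • e 1)
    (h1 : ∀ k, T (e (k + 1)) = (√(γ k) : ℂ) • e k + (√(γ (k + 1)) : ℂ) • e (k + 2)) (k : ℕ) :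
    Polynomial.aeval T (jacobiPoly (fun _ => 0) γ k) (e 0)
      = ((∏ i ∈ Finset.range k, √(γ i) : ℝ) : ℂ) • e k := by
  induction k using Nat.twoStepInduction with
  | zero => simp [jacobiPoly]
  | one => simp [jacobiPoly, h0]
  | more k ih0 ih1 =>
    rw [jacobiPoly, map_sub, map_mul, map_mul, Polynomial.aeval_C, sub_apply,
      mul_apply_eq_comp, mul_apply_eq_comp, ih0, ih1]
    have h : ((√(γ k) : ℝ) : ℂ) * ((√(γ k) : ℝ) : ℂ) = (γ k : ℂ) := by
      rw [← Complex.ofReal_mul, Real.mul_self_sqrt (hγ k)]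
    have hC (v : E) : (algebraMap ℝ (E →L[ℂ] E) (γ k)) v = (γ k : ℂ) • v := by
      rw [Algebra.algebraMap_eq_smul_one]
      exact (Complex.coe_smul _ _).symm
    rw [hC]
    simp only [map_zero, sub_zero, Polynomial.aeval_X, map_smul, h1, Finset.prod_range_succ,
      Complex.ofReal_mul, ← h]
    module

/-! ### Spectral measures -/

section SpectralMeasure

variable {E : Type*} [NormedAddCommGroup E] [InnerProductSpace ℂ E] [CompleteSpace E]

theorem isSelfAdjoint_aeval {T : E →L[ℂ] E} (hT : IsSelfAdjoint T) (q : Polynomial ℝ) :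
    IsSelfAdjoint (Polynomial.aeval T q) := by
  induction q using Polynomial.induction_on' with
  | add a b ha hb => rw [map_add]; exact ha.add hb
  | monomial n c =>
    rw [Polynomial.aeval_monomial, ← Algebra.smul_def]
    exact (IsSelfAdjoint.all c).smul (hT.pow n)

/-- The spectral measure of a bounded self-adjoint operator at a vector. -/
theorem exists_measure_integral_eval_eq_inner {T : E →L[ℂ] E} (hT : IsSelfAdjoint T) (v : E) :
    ∃ μ : Measure ℝ, IsFiniteMeasure μ ∧ (∀ m : ℕ, Integrable (fun x : ℝ => x ^ m) μ) ∧
      ∀ q : Polynomial ℝ, ∫ x, q.eval x ∂μ = (⟪v, Polynomial.aeval T q v⟫_ℂ).re := by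
  open scoped CompactlySupported in
  -- The measure comes from Riesz–Markov–Kakutani applied to f ↦ Re⟨v, f(T)v⟩; compact support is
  -- automatic on the compact spectrum.
  let ψ : C_c(spectrum ℝ T, ℝ) →ₗ[ℝ] ℝ :=
    { toFun := fun f => (⟪v, cfcHom hT (f : C(spectrum ℝ T, ℝ)) v⟫_ℂ).re
      map_add' := fun f g => by
        have : ((f + g : C_c(spectrum ℝ T, ℝ)) : C(spectrum ℝ T, ℝ)) = f + g := rfl
        rw [this, map_add, add_apply, inner_add_right, Complex.add_re]
      map_smul' := fun c f => by
        have : ((c • f : C_c(spectrum ℝ T, ℝ)) : C(spectrum ℝ T, ℝ)) = c • (f : C(_, ℝ)) := rfl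
        rw [this, map_smul, smul_apply, inner_smul_right_eq_smul]
        simp }
  have hψ : ∀ f, 0 ≤ f → 0 ≤ ψ f := by
    intro f hf
    -- With g = √f, the value at f is ‖g(T)v‖².
    let g : C(spectrum ℝ T, ℝ) := ⟨fun x => √(f x), by fun_prop⟩
    have hfg : (f : C(spectrum ℝ T, ℝ)) = star g * g := by
      ext x
      exact (Real.mul_self_sqrt (hf x)).symm
    change 0 ≤ (⟪v, cfcHom hT (f : C(spectrum ℝ T, ℝ)) v⟫_ℂ).re
    rw [hfg, map_mul, map_star, mul_apply_eq_comp, ContinuousLinearMap.star_eq_adjoint,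
      ContinuousLinearMap.adjoint_inner_right]
    exact inner_self_nonneg (𝕜 := ℂ)
  let Λ := PositiveLinearMap.mk₀ ψ hψ
  let ν := RealRMK.rieszMeasure Λ
  have hν (f : C(spectrum ℝ T, ℝ)) : ∫ x, f x ∂ν = (⟪v, cfcHom hT f v⟫_ℂ).re :=
    RealRMK.integral_rieszMeasure Λ (CompactlySupportedContinuousMap.continuousMapEquiv f)
  have hfin : IsFiniteMeasure ν := inferInstance
  have hval : Measurable (Subtype.val : spectrum ℝ T → ℝ) := measurable_subtype_coe
  refine ⟨ν.map Subtype.val, inferInstance, fun m => ?_, fun q => ?_⟩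
  · rw [integrable_map_measure (by fun_prop) hval.aemeasurable]
    exact Continuous.integrable_of_hasCompactSupport (by fun_prop)
      (HasCompactSupport.of_compactSpace _)
  · rw [integral_map hval.aemeasurable (by fun_prop)]
    have h1 := hν (Polynomial.toContinuousMapOnAlgHom (spectrum ℝ T) q)
    have h2 : cfcHom hT (Polynomial.toContinuousMapOnAlgHom (spectrum ℝ T) q)
        = Polynomial.aeval T q := by
      have e : ((cfcHom (R := ℝ) hT : C(spectrum ℝ T, ℝ) →⋆ₐ[ℝ] (E →L[ℂ] E)) :
          C(spectrum ℝ T, ℝ) →ₐ[ℝ] (E →L[ℂ] E)).comp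
          (Polynomial.toContinuousMapOnAlgHom (spectrum ℝ T)) = Polynomial.aeval T := by
        refine Polynomial.algHom_ext ?_
        rw [Polynomial.aeval_X]
        refine Eq.trans ?_ (cfcHom_id (R := ℝ) hT)
        simp [Polynomial.toContinuousMapOn_X_eq_restrict_id]
      exact DFunLike.congr_fun e q
    rw [h2] at h1
    exact h1

/-- The spectral measure at `e 0` of an operator acting on the orthonormal family `e` as a Jacobi
matrix has the corresponding Jacobi coefficients. -/
theorem exists_hasJacobiCoefficients_of_isSelfAdjoint {T : E →L[ℂ] E} (hT : IsSelfAdjoint T)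
    {e : ℕ → E} (he : Orthonormal ℂ e) {γ : ℕ → ℝ} (hγ : ∀ k, 0 < γ k)
    (h0 : T (e 0) = (√(γ 0) : ℂ) • e 1)
    (h1 : ∀ k, T (e (k + 1)) = (√(γ k) : ℂ) • e k + (√(γ (k + 1)) : ℂ) • e (k + 2)) :
    ∃ μ : Measure ℝ, IsProbabilityMeasure μ ∧ HasJacobiCoefficients μ (fun _ => 0) γ := by
  obtain ⟨μ, hfin, hint, hμ⟩ := exists_measure_integral_eval_eq_inner hT (e 0)
  have hite := orthonormal_iff_ite.1 he
  refine ⟨μ, ⟨?_⟩, hint, hγ, fun i j hij => ?_⟩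
  -- The total mass is ‖`e 0`‖² = 1.
  · have h := hμ 1
    simp only [Polynomial.eval_one, map_one, one_apply_eq_self, hite,
      if_true, Complex.one_re, integral_const, smul_eq_mul, mul_one] at h
    rwa [measureReal_def, ENNReal.toReal_eq_one_iff] at h
  · have h := hμ (jacobiPoly (fun _ => 0) γ i * jacobiPoly (fun _ => 0) γ j)
    simp only [Polynomial.eval_mul] at h
    have hadj := (isSelfAdjoint_aeval hT (jacobiPoly (fun _ => 0) γ i)).adjoint_eq
    rw [h, map_mul, mul_apply_eq_comp, ← ContinuousLinearMap.adjoint_inner_left, hadj,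
      aeval_jacobiPoly_apply (fun k => (hγ k).le) h0 h1,
      aeval_jacobiPoly_apply (fun k => (hγ k).le) h0 h1, inner_smul_left, inner_smul_right,
      hite, if_neg hij]
    simp

end SpectralMeasure

/-! ### Existence for bounded coefficients -/

theorem exists_isProbabilityMeasure_hasJacobiCoefficients {γ : ℕ → ℝ} (hγ : ∀ k, 0 < γ k)
    {B : ℝ} (hB : ∀ k, γ k ≤ B) :
    ∃ μ : Measure ℝ, IsProbabilityMeasure μ ∧ HasJacobiCoefficients μ (fun _ => 0) γ := by
  have ha : ∀ k, |√(γ k)| ≤ √B := fun k => by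
    rw [abs_of_nonneg (Real.sqrt_nonneg _)]
    exact Real.sqrt_le_sqrt (hB k)
  refine exists_hasJacobiCoefficients_of_isSelfAdjoint
    (isSelfAdjoint_jacobiOperator (fun k => √(γ k)) √B ha)
    (orthonormal_iff_ite.2 inner_unitVec) hγ ?_ fun k => ?_
  · rw [jacobiOperator, add_apply, weightedShift_unitVec_zero, adjoint_weightedShift_unitVec,
      zero_add]
  · rw [jacobiOperator, add_apply, weightedShift_unitVec_succ, adjoint_weightedShift_unitVec]

theorem exists_forall_gammaSeq_le (n : ℕ) {ps : ℕ → ℝ} {p : ℝ} (hps : ∀ k, k < n → 0 < ps k)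
    (hp : 0 < p) : ∃ B, ∀ k, gammaSeq n ps p k ≤ B := by
  have hnn : ∀ i ∈ Finset.range n, 0 ≤ ps i := fun i hi => (hps i (Finset.mem_range.1 hi)).le
  refine ⟨∑ i ∈ Finset.range n, ps i + p, fun k => ?_⟩
  rw [gammaSeq]
  split_ifs with hk
  · linarith [Finset.single_le_sum hnn (Finset.mem_range.2 hk)]
  · linarith [Finset.sum_nonneg hnn]

theorem gammaSeq_pos {n : ℕ} {ps : ℕ → ℝ} {p : ℝ} (hps : ∀ k, k < n → 0 < ps k)
    (hp : 0 < p) (k : ℕ) : 0 < gammaSeq n ps p k := by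
  rw [gammaSeq]
  split_ifs with hk
  exacts [hps k hk, hp]

/-! ### The theorem and the cases n = 1, 2, 3 -/

theorem theorem5p1 (n : ℕ) (hn : 1 ≤ n) (ps : ℕ → ℝ) (p : ℝ)
    (hps : ∀ k, k < n → 0 < ps k) (hp : 0 < p) :
    (∃ μ : Measure ℝ, IsProbabilityMeasure μ ∧
      HasJacobiCoefficients μ (fun _ => 0) (gammaSeq n ps p)) ∧
    ∀ μ : Measure ℝ, IsProbabilityMeasure μ →
      HasJacobiCoefficients μ (fun _ => 0) (gammaSeq n ps p) →
      ∀ z : ℂ, (∀ x ∈ μ.support, (x : ℂ) ≠ z) →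
        (shiftedPi n ps p z n ≠ 0 ∧
          stieltjesTransform μ z = shiftedPi n ps p z (n - 1) / shiftedPi n ps p z n) ∧
        (n = 1 →
          ((p : ℂ) - ps 0) * z ^ 2 + (ps 0 : ℂ) ^ 2 ≠ 0 →
          stieltjesTransform μ z =
            1 / 2 * (((2 * p - ps 0) * z - ps 0 * sqrtBranch p z) /
              ((p - ps 0) * z ^ 2 + (ps 0 : ℂ) ^ 2))) ∧
        (n = 2 →
          (2 * (p : ℂ) - ps 1) * z ^ 2 - 2 * ps 0 * p + ps 1 * z * sqrtBranch p z ≠ 0 ∧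
          stieltjesTransform μ z =
            ((2 * p - ps 1) * z + ps 1 * sqrtBranch p z) /
              ((2 * p - ps 1) * z ^ 2 - 2 * ps 0 * p + ps 1 * z * sqrtBranch p z)) ∧
        (n = 3 →
          (2 * (p : ℂ) - ps 2) * z ^ 3 + (ps 0 * ps 2 - 2 * ps 0 * p - 2 * ps 1 * p) * z
              + ps 2 * (z ^ 2 - ps 0) * sqrtBranch p z ≠ 0 ∧
          stieltjesTransform μ z =
            ((2 * p - ps 2) * z ^ 2 - 2 * ps 1 * p + ps 2 * z * sqrtBranch p z) /
              ((2 * p - ps 2) * z ^ 3 + (ps 0 * ps 2 - 2 * ps 0 * p - 2 * ps 1 * p) * z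
                + ps 2 * (z ^ 2 - ps 0) * sqrtBranch p z)) := by
  refine ⟨?_, fun μ hprob h z hz => ?_⟩
  · obtain ⟨B, hB⟩ := exists_forall_gammaSeq_le n hps hp
    exact exists_isProbabilityMeasure_hasJacobiCoefficients (gammaSeq_pos hps hp) hB
  obtain ⟨hne, hG⟩ := stieltjesTransform_eq_shiftedPi_div hn hps hp h hz
  have hpC : (p : ℂ) ≠ 0 := by exact_mod_cast hp.ne'
  have h2p : 2 * (p : ℂ) ≠ 0 := mul_ne_zero two_ne_zero hpC
  have hA : 2 * (p : ℂ) * tailA p z = z - sqrtBranch p z := by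
    rw [tailA, mul_div_cancel₀ _ h2p]
  have hs := sqrtBranch_sq hp.le z
  refine ⟨⟨hne, hG⟩, fun hn1 hC => ?_, fun hn2 => ?_, fun hn3 => ?_⟩
  -- Here the stated fraction is rationalised: the conjugate of 2pΠ₀ has been multiplied in, and the
  -- product is 4p((p - p₀)z² + p₀²). Hence the separate nonvanishing hypothesis; for n = 2, 3
  -- numerator and denominator are only scaled by 2p.
  · subst hn1
    simp only [shiftedPi, Nat.sub_self] at hne hG
    rw [hG, ← mul_div_assoc, div_eq_div_iff hne hC]
    refine mul_left_cancel₀ h2p ?_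
    linear_combination
      (1 / 2 * ((2 * p - ps 0) * z - ps 0 * sqrtBranch p z) * ps 0) * hA
        + (1 / 2 * ps 0 ^ 2 : ℂ) * hs
  · subst hn2
    simp only [shiftedPi, Nat.sub_self, Nat.add_one_sub_one, zero_add] at hne hG
    have hnum : (2 * (p : ℂ) - ps 1) * z + ps 1 * sqrtBranch p z
        = 2 * p * (z - ps 1 * tailA p z) := by
      linear_combination (ps 1 : ℂ) * hA
    have hden : (2 * (p : ℂ) - ps 1) * z ^ 2 - 2 * ps 0 * p + ps 1 * z * sqrtBranch p z
        = 2 * p * (z * (z - ps 1 * tailA p z) - ps 0 * 1) := by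
      linear_combination (ps 1 * z : ℂ) * hA
    rw [hnum, hden, mul_div_mul_left _ _ h2p]
    exact ⟨mul_ne_zero h2p hne, hG⟩
  · subst hn3
    simp only [shiftedPi, Nat.sub_self, Nat.add_one_sub_one, zero_add, Nat.reduceAdd,
      Nat.reduceSub] at hne hG
    have hnum : (2 * (p : ℂ) - ps 2) * z ^ 2 - 2 * ps 1 * p + ps 2 * z * sqrtBranch p z
        = 2 * p * (z * (z - ps 2 * tailA p z) - ps 1 * 1) := by
      linear_combination (ps 2 * z : ℂ) * hA
    have hden : (2 * (p : ℂ) - ps 2) * z ^ 3 + (ps 0 * ps 2 - 2 * ps 0 * p - 2 * ps 1 * p) * z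
          + ps 2 * (z ^ 2 - ps 0) * sqrtBranch p z
        = 2 * p * (z * (z * (z - ps 2 * tailA p z) - ps 1 * 1)
          - ps 0 * (z - ps 2 * tailA p z)) := by
      linear_combination (ps 2 * (z ^ 2 - ps 0) : ℂ) * hA
    rw [hnum, hden, mul_div_mul_left _ _ h2p]
    exact ⟨mul_ne_zero h2p hne, hG⟩
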